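/- Let $H$ be a separable complex Hilbert space with orthonormal basis $\{e_i : i\in\Theta\}$, where $\Theta$ is countable (finite or infinite) with at least two elements, and let $\omega_i>0$ $(i\in\Theta)$ satisfy $\sum_{i}\omega_i=1$. Let $\mathcal F(H)=\bigoplus_{n\ge 0}H^{\otimes n}$ be the full Fock space, let $l_i\eta=e_i\otimes\eta$ be the left creation operators, and let $$P_\omega(x)=\sum_{i\in\Theta}\omega_i\,l_i^*\,x\,l_i,\qquad x\in B(\mathcal F(H)).$$ For $\lambda$ in the unit circle $\mathbb T$ let $x_\lambda$ be the unitary acting on $H^{\otimes n}$ as multiplication by $\lambda^n$. For a normal unital completely positive map $\tau$ on $B(G)$ ($G$ a Hilbert space) let $F(\tau)=\{x:\tau(x)=x\}$ be its Poisson boundary, with the Choi–Effros product $a\circ b=\mathrm{SOT}\text{-}\lim_{n}\tau^n(ab)$ for $a,b\in F(\tau)$. Let $P(\tau)$ be its peripheral Poisson boundary, i.e. the norm closed linear span of all $x$ with $\tau(x)=\lambda x$ for some $\lambda\in\mathbb T$ (and likewise for a normal unital $*$-endomorphism $\theta$ of a von Neumann algebra). The peripheral product on $P(\tau)$ is $x\circ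 y=T(T^{-1}(x)T^{-1}(y))$. Here $(K,\mathcal B,\theta)$ is the minimal dilation of $\tau$: $K\supseteq G$ is a Hilbert space, $p$ is the projection of $K$ onto $G$, $\mathcal B\subseteq B(K)$ is a von Neumann algebra with $p\mathcal Bp=B(G)$, $\theta$ is a normal unital $*$-endomorphism of $\mathcal B$ with $p\,\theta^n(x)\,p=\tau^n(x)$ for $x\in B(G)$ and $n\ge 0$, the operators $\theta^n(x)$ generate $\mathcal B$, and the vectors $\theta^{n_1}(x_1)\cdots\theta^{n_k}(x_k)h$ ($x_j\in B(G)$, $h\in G$) are total in $K$. The map $T:P(\theta)\to P(\tau)$ is the compression $z\mapsto pzp$. Let $a,b\in F(P_\omega)$ and $\lambda,\mu\in\mathbb T\setminus\{1\}$. Then the Choi–Effros product $a\circ b=\mathrm{SOT}\text{-}\lim_n P_\omega^n(ab)$ exists, $x_\lambda a$ and $b x_\mu$ belong to $P(P_\omega)$, and $$\mathrm{SOT}\text{-}\lim_{n\to\infty}(\lambda\mu)^{-n}P_\omega^n\big((x_\lambda a)(b x_\mu)\big)=x_\lambda\,(a\circ b)\,x_\mu .$$ Moreover, for every minimal dilation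 of $P_\omega$ the compression $T:P(\theta)\to P(P_\omega)$ is a bijection, and the peripheral product satisfies $$(x_\lambda a)\circ(b x_\mu)=x_\lambda\,(a\circ b)\,x_\mu .$$ -/

import Mathlib

open scoped TensorProduct ENNReal
open Filter Topology

universe u v w

noncomputable section

namespace PeripheralPoisson

/-! ### The full Fock space of a Hilbert space -/

/-- A bundled complex Hilbert space, used to define Hilbert tensor powers by recursion. -/
structure HilbertObj : Type (u + 1) where
  carrier : Type u
  [normed : NormedAddCommGroup carrier]
  [inner : InnerProductSpace ℂ carrier]
  [complete : CompleteSpace carrier]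

attribute [instance] HilbertObj.normed HilbertObj.inner HilbertObj.complete

section Fock

variable (H : Type u) [NormedAddCommGroup H] [InnerProductSpace ℂ H]

/-- The Hilbert tensor powers of `H`: the zeroth one is the one-dimensional Hilbert space, and the
`(n + 1)`-st one is the completion of the algebraic tensor product of `H` with the `n`-th one, for
the inner product `⟪ξ ⊗ η, ξ' ⊗ η'⟫ = ⟪ξ, ξ'⟫ ⟪η, η'⟫`. -/
def tensorPowerObj : ℕ → HilbertObj.{u}
  | 0 => { carrier := EuclideanSpace ℂ PUnit.{u + 1} }
  | n + 1 => { carrier := UniformSpace.Completion (H ⊗[ℂ] (tensorPowerObj n).carrier) }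

/-- The `n`-th Hilbert tensor power of `H`. -/
abbrev TensorPower (n : ℕ) : Type u := (tensorPowerObj H n).carrier

/-- The full Fock space of `H`, the Hilbert space direct sum of the tensor powers of `H`. -/
abbrev FockSpace : Type u := lp (fun n : ℕ => TensorPower H n) 2

variable {H}

/-- The vacuum vector. -/
def vacuum : FockSpace H :=
  lp.single (E := fun n : ℕ => TensorPower H n) 2 0
    (EuclideanSpace.single PUnit.unit (1 : ℂ) : EuclideanSpace ℂ PUnit.{u + 1})

/-- The map `η ↦ ξ ⊗ η` from the `n`-th to the `(n + 1)`-st tensor power. -/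
def tensorLeft (ξ : H) (n : ℕ) : TensorPower H n →L[ℂ] TensorPower H (n + 1) :=
  (UniformSpace.Completion.toComplL (𝕜 := ℂ) (E := H ⊗[ℂ] TensorPower H n)).comp
    (TensorProduct.mkL ℂ H (TensorPower H n) ξ)

lemma norm_tensorLeft (ξ : H) (n : ℕ) (η : TensorPower H n) :
    ‖tensorLeft ξ n η‖ = ‖ξ‖ * ‖η‖ := by
  refine (UniformSpace.Completion.norm_coe (ξ ⊗ₜ[ℂ] η : H ⊗[ℂ] TensorPower H n)).trans ?_
  rw [TensorProduct.norm_tmul]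

/-- The components of `ξ ⊗ f` for `f` in the Fock space. -/
def creationFun (ξ : H) (f : ∀ n, TensorPower H n) : ∀ n, TensorPower H n
  | 0 => 0
  | n + 1 => tensorLeft ξ n (f n)

lemma hasSum_creationFun (ξ : H) (f : FockSpace H) :
    HasSum (fun n => ‖creationFun ξ f n‖ ^ (2 : ℝ)) ((‖ξ‖ * ‖f‖) ^ (2 : ℝ)) := by
  have h := (lp.hasSum_norm (p := 2) (by norm_num) f).mul_left (‖ξ‖ ^ (2 : ℝ))
  simp only [ENNReal.toReal_ofNat] at h
  rw [← Real.mul_rpow (norm_nonneg _) (norm_nonneg _)] at h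
  refine (hasSum_nat_add_iff' 1).1 ?_
  simp only [creationFun, norm_tensorLeft, Finset.range_one, Finset.sum_singleton, norm_zero]
  rw [Real.zero_rpow (by norm_num), sub_zero]
  simpa [Real.mul_rpow (norm_nonneg _) (norm_nonneg _)] using h

lemma memlp_creationFun (ξ : H) (f : FockSpace H) : Memℓp (creationFun ξ f) 2 :=
  memℓp_gen (by simpa using (hasSum_creationFun ξ f).summable)

/-- The left creation operator `η ↦ ξ ⊗ η` on the full Fock space. -/
def leftCreation (ξ : H) : FockSpace H →L[ℂ] FockSpace H :=
  LinearMap.mkContinuous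
    { toFun := fun f => ⟨creationFun ξ f, memlp_creationFun ξ f⟩
      map_add' := fun f g => by
        ext n
        cases n with
        | zero => exact (add_zero (0 : TensorPower H 0)).symm
        | succ n => exact map_add (tensorLeft ξ n) (f n) (g n)
      map_smul' := fun c f => by
        ext n
        cases n with
        | zero => exact (smul_zero (A := TensorPower H 0) c).symm
        | succ n => exact map_smul (tensorLeft ξ n) c (f n) }
    ‖ξ‖ (fun f => by
      have h := lp.hasSum_norm (p := 2) (by norm_num)
        (⟨creationFun ξ f, memlp_creationFun ξ f⟩ : FockSpace H)
      simp only [ENNReal.toReal_ofNat] at h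
      have h2 := h.unique (hasSum_creationFun ξ f)
      exact ((Real.rpow_left_inj (norm_nonneg _) (by positivity) (by norm_num)).1 h2).le)

lemma leftCreation_apply_zero (ξ : H) (f : FockSpace H) : leftCreation ξ f 0 = 0 := rfl

lemma leftCreation_apply_succ (ξ : H) (f : FockSpace H) (n : ℕ) :
    leftCreation ξ f (n + 1) = tensorLeft ξ n (f n) := rfl

/-- The unitary `x_z`, for `z` in the unit circle, which multiplies the `n`-particle space
`H^{⊗n}` by `z ^ n`; equivalently `x_z e_I = z ^ |I| e_I` (see `phase_basisVector`). -/
def phase (z : Circle) : FockSpace H →L[ℂ] FockSpace H :=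
  lp.mapCLM (𝕜 := ℂ) 2
    (fun n : ℕ => ((z : ℂ) ^ n) • ContinuousLinearMap.id ℂ (TensorPower H n)) zero_le_one
    (fun n => by
      refine (norm_smul_le _ _).trans ?_
      rw [norm_pow, Circle.norm_coe, one_pow, one_mul]
      exact ContinuousLinearMap.norm_id_le)

lemma phase_apply (z : Circle) (f : FockSpace H) (n : ℕ) :
    phase z f n = ((z : ℂ) ^ n) • f n := rfl

/-- The vector `e_I = e_{i_1} ⊗ ⋯ ⊗ e_{i_k}` for a word `I = i_1 ⋯ i_k`; it is the vacuum for the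
empty word. -/
def basisVector {Θ : Type w} (e : Θ → H) : List Θ → FockSpace H
  | [] => vacuum
  | i :: I => leftCreation (e i) (basisVector e I)

lemma phase_leftCreation (z : Circle) (ξ : H) (f : FockSpace H) :
    phase z (leftCreation ξ f) = (z : ℂ) • leftCreation ξ (phase z f) := by
  ext n
  cases n with
  | zero => simp [phase_apply, leftCreation_apply_zero]
  | succ n => simp [phase_apply, leftCreation_apply_succ, smul_smul, pow_succ']

lemma phase_basisVector {Θ : Type w} (e : Θ → H) (z : Circle) (I : List Θ) :
    phase z (basisVector e I) = ((z : ℂ) ^ I.length) • basisVector e I := by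
  induction I with
  | nil =>
    ext n
    cases n with
    | zero => simp [phase_apply, basisVector]
    | succ n =>
      have h : (vacuum : FockSpace H) (n + 1) = 0 :=
        lp.single_apply_ne (E := fun n : ℕ => TensorPower H n) 2 0 _ (Nat.succ_ne_zero n)
      simp [phase_apply, basisVector, h]
  | cons i I ih =>
    simp only [basisVector, phase_leftCreation, ih, map_smul, smul_smul, List.length_cons, pow_succ']

/-- The map `P_ω(x) = ∑ᵢ ωᵢ lᵢ* x lᵢ` on `B(F(H))`, where `lᵢ` is the left creation operator of
`e i`. For a probability weight `ω` and an orthonormal `e` the series converges absolutely in the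
operator norm. -/
def fockMap {Θ : Type w} (e : Θ → H) (ω : Θ → ℝ)
    (x : FockSpace H →L[ℂ] FockSpace H) : FockSpace H →L[ℂ] FockSpace H :=
  ∑' i, (ω i : ℂ) • (ContinuousLinearMap.adjoint (leftCreation (e i)) * x * leftCreation (e i))

lemma norm_leftCreation_le (ξ : H) : ‖leftCreation ξ‖ ≤ ‖ξ‖ :=
  LinearMap.mkContinuous_norm_le _ (norm_nonneg _) _

lemma summable_fockMap {Θ : Type w} {e : Θ → H} (he : Orthonormal ℂ e) {ω : Θ → ℝ}
    (hω : ∀ i, 0 < ω i) (hsum : HasSum ω 1) (x : FockSpace H →L[ℂ] FockSpace H) :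
    Summable fun i =>
      ‖(ω i : ℂ) • (ContinuousLinearMap.adjoint (leftCreation (e i)) * x * leftCreation (e i))‖ := by
  refine Summable.of_nonneg_of_le (fun _ => norm_nonneg _) (fun i => ?_) (hsum.summable.mul_right ‖x‖)
  have h1 : ‖leftCreation (e i)‖ ≤ 1 := (norm_leftCreation_le _).trans (he.1 i).le
  rw [norm_smul, Complex.norm_real, Real.norm_of_nonneg (hω i).le]
  refine mul_le_mul_of_nonneg_left ?_ (hω i).le
  refine (norm_mul_le _ _).trans ?_
  refine (mul_le_mul (norm_mul_le _ _) h1 (norm_nonneg _) (by positivity)).trans ?_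
  rw [mul_one, LinearIsometryEquiv.norm_map]
  exact mul_le_of_le_one_left (norm_nonneg _) h1

end Fock

/-! ### Poisson boundaries and peripheral Poisson boundaries -/

/-- Convergence in the strong operator topology. -/
def SOTTendsto {ι : Type w} {K : Type v} [NormedAddCommGroup K] [NormedSpace ℂ K]
    (f : ι → K →L[ℂ] K) (l : Filter ι) (c : K →L[ℂ] K) : Prop :=
  ∀ ξ : K, Tendsto (fun i => f i ξ) l (𝓝 (c ξ))

/-- The fixed point space `F(τ)` (the noncommutative Poisson boundary). -/
def poissonBoundary {R : Type v} (τ : R → R) : Set R := {x | τ x = x}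

/-- The eigenspace `E_z(τ)` of an eigenvalue `z` in the unit circle. -/
def peripheralEigenspace {R : Type v} [SMul ℂ R] (τ : R → R) (z : Circle) : Set R :=
  {x | τ x = (z : ℂ) • x}

/-- The peripheral Poisson boundary `P(τ)`: the norm closed linear span of all eigenvectors of `τ`
with eigenvalue in the unit circle. -/
def peripheralPoissonBoundary {R : Type v} [AddCommGroup R] [Module ℂ R] [TopologicalSpace R]
    (τ : R → R) : Set R :=
  closure (Submodule.span ℂ (⋃ z : Circle, peripheralEigenspace τ z) : Set R)

open Classical in
/-- The Choi–Effros product `x ∘ y = SOT-lim τⁿ(x y)` (zero if the limit does not exist). -/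
def choiEffros {K : Type v} [NormedAddCommGroup K] [InnerProductSpace ℂ K]
    (τ : (K →L[ℂ] K) → (K →L[ℂ] K)) (x y : K →L[ℂ] K) : K →L[ℂ] K :=
  if h : ∃ c, SOTTendsto (fun n : ℕ => τ^[n] (x * y)) atTop c then h.choose else 0

/-- A map between von Neumann algebras is normal if it preserves suprema of increasing nets. -/
def IsNormalMap {A B : Type*} [LE A] [LE B] (f : A → B) : Prop :=
  ∀ (S : Set A) (b : A), S.Nonempty → DirectedOn (· ≤ ·) S → IsLUB S b → IsLUB (f '' S) (f b)

/-- A minimal dilation `(K, 𝓑, θ)` of a map `τ` on `B(G)`: a Hilbert space `K` containing `G` (through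
the isometry `V`), a von Neumann algebra `𝓑` on `K` whose corner by the projection `p` onto `G` is
`B(G)`, and a normal unital *-endomorphism `θ` of `𝓑` with `p θⁿ(x) p = τⁿ(x)` for `x` in
`B(G) = p 𝓑 p`, such that the vectors `θ^{n₁}(x₁) ⋯ θ^{nₖ}(xₖ) h` are total in `K` and the
operators `θⁿ(x)` generate `𝓑`. An operator `x` on `G` is identified with `V x V*` on `K`. -/
structure MinimalDilation {G : Type u} [NormedAddCommGroup G] [InnerProductSpace ℂ G]
    [CompleteSpace G] (τ : (G →L[ℂ] G) → (G →L[ℂ] G)) where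
  K : Type v
  [normed : NormedAddCommGroup K]
  [inner : InnerProductSpace ℂ K]
  [complete : CompleteSpace K]
  V : G →ₗᵢ[ℂ] K
  𝓑 : VonNeumannAlgebra K
  corner_mem : ∀ x : G →L[ℂ] G,
    V.toContinuousLinearMap ∘L x ∘L ContinuousLinearMap.adjoint V.toContinuousLinearMap ∈
      𝓑.toStarSubalgebra
  θ : 𝓑.toStarSubalgebra →⋆ₐ[ℂ] 𝓑.toStarSubalgebra
  normal : IsNormalMap θ
  dilates : ∀ (n : ℕ) (x : G →L[ℂ] G),
    ContinuousLinearMap.adjoint V.toContinuousLinearMap ∘L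
      (θ^[n] ⟨_, corner_mem x⟩ : K →L[ℂ] K) ∘L V.toContinuousLinearMap = τ^[n] x
  total : (Submodule.span ℂ
    {ξ : K | ∃ (L : List (ℕ × (G →L[ℂ] G))) (h : G),
      ξ = (L.map fun q => (θ^[q.1] ⟨_, corner_mem q.2⟩ : K →L[ℂ] K)).prod (V h)}).topologicalClosure
      = ⊤
  generates : Set.centralizer (Set.centralizer
    {z : K →L[ℂ] K | ∃ (n : ℕ) (x : G →L[ℂ] G), z = θ^[n] ⟨_, corner_mem x⟩}) = (𝓑 : Set (K →L[ℂ] K))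

attribute [instance] MinimalDilation.normed MinimalDilation.inner MinimalDilation.complete

namespace MinimalDilation

variable {G : Type u} [NormedAddCommGroup G] [InnerProductSpace ℂ G] [CompleteSpace G]
  {τ : (G →L[ℂ] G) → (G →L[ℂ] G)}

/-- The compression `z ↦ p z p` from `𝓑` to `B(G)`. -/
def compression (D : MinimalDilation.{u, v} τ) (z : D.𝓑.toStarSubalgebra) : G →L[ℂ] G :=
  ContinuousLinearMap.adjoint D.V.toContinuousLinearMap ∘L
    (z : D.K →L[ℂ] D.K) ∘L D.V.toContinuousLinearMap

/-- The inverse `T⁻¹` of the compression `T : P(θ) → P(τ)`. -/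
def lift (D : MinimalDilation.{u, v} τ) (x : G →L[ℂ] G) : D.𝓑.toStarSubalgebra :=
  Function.invFunOn D.compression (peripheralPoissonBoundary D.θ) x

/-- The product `x ∘ y = T(T⁻¹(x) T⁻¹(y))` of the peripheral Poisson boundary `P(τ)`, where `T` is the
compression from `P(θ)` to `P(τ)`. -/
def peripheralProduct (D : MinimalDilation.{u, v} τ) (x y : G →L[ℂ] G) : G →L[ℂ] G :=
  D.compression (D.lift x * D.lift y)

end MinimalDilation

end PeripheralPoisson

end

noncomputable section

namespace PeripheralPoisson

/-! Both sides of the product formula are strong limits of the same sequence `(zw)⁻ⁿ P_ωⁿ(xy)`, with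
`x = phase z * a` and `y = b * phase w`.

On the Fock space, `phase z` commutes with each creation operator up to the factor `z`. Hence `P_ω`
pulls phases out on either side at the cost of a scalar (`fockMap_phase_mul`, `fockMap_mul_phase`),
so `x` and `y` are eigenvectors and the sequence equals `phase z * P_ωⁿ(ab) * phase w`. The limit of
`P_ωⁿ(ab)` exists because Kadison–Schwarz makes `P_ωⁿ(x*x)` increase for a fixed point `x`, and
polarization reduces `ab` to such squares.

On the dilation, for a unital `τ`, the projections `pₙ = θⁿ(p)` increase strongly to 1, and `pₙ
θⁿ(z) pₙ = θⁿ(pzp)`. An eigenvector `x` lifts to the strong limit of the martingale `c⁻ⁿ θⁿ(x)`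
(`exists_eigen_lift`). Combinations of eigenvectors of `θ` return close to themselves under
infinitely many `θⁿ`, so such a `z` is approximated by `θⁿ(pzp)` and compression is isometric
(`norm_le_norm_compression`); hence `T` is a bijection. Multiplying the martingales of two lifts and
compressing gives the same sequence again. -/

lemma SOTTendsto.mul_left {ι : Type*} {K : Type*} [NormedAddCommGroup K] [NormedSpace ℂ K]
    {f : ι → K →L[ℂ] K} {l : Filter ι} {c : K →L[ℂ] K} (h : SOTTendsto f l c) (x : K →L[ℂ] K) :
    SOTTendsto (fun n => x * f n) l (x * c) :=
  fun ξ => (x.continuous.tendsto _).comp (h ξ)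

lemma SOTTendsto.mul_right {ι : Type*} {K : Type*} [NormedAddCommGroup K] [NormedSpace ℂ K]
    {f : ι → K →L[ℂ] K} {l : Filter ι} {c : K →L[ℂ] K} (h : SOTTendsto f l c) (x : K →L[ℂ] K) :
    SOTTendsto (fun n => f n * x) l (c * x) :=
  fun ξ => h (x ξ)

lemma SOTTendsto.unique {ι : Type*} {K : Type*} [NormedAddCommGroup K] [NormedSpace ℂ K]
    {f : ι → K →L[ℂ] K} {l : Filter ι} [l.NeBot] {c d : K →L[ℂ] K}
    (hc : SOTTendsto f l c) (hd : SOTTendsto f l d) : c = d :=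
  ContinuousLinearMap.ext fun ξ => tendsto_nhds_unique (hc ξ) (hd ξ)

lemma exists_sotTendsto_of_cauchySeq {K : Type*} [NormedAddCommGroup K] [NormedSpace ℂ K]
    [CompleteSpace K] {f : ℕ → K →L[ℂ] K} (h : ∀ ξ, CauchySeq fun n => f n ξ) :
    ∃ c, SOTTendsto f atTop c := by
  choose g hg using fun ξ => cauchySeq_tendsto_of_complete (h ξ)
  exact ⟨continuousLinearMapOfTendsto f (tendsto_pi_nhds.2 hg), hg⟩

lemma ofReal_smul_nonneg {K : Type*} [NormedAddCommGroup K] [InnerProductSpace ℂ K] {r : ℝ}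
    (hr : 0 ≤ r) {T : K →L[ℂ] K} (hT : 0 ≤ T) : 0 ≤ (r : ℂ) • T := by
  rw [ContinuousLinearMap.nonneg_iff_isPositive] at hT ⊢
  exact hT.smul_of_nonneg (RCLike.ofReal_nonneg.2 hr)

/-! ### Strong convergence of bounded increasing sequences of operators. -/

section Monotone

variable {K : Type*} [NormedAddCommGroup K] [InnerProductSpace ℂ K] [CompleteSpace K]

/-- With `T = S*S` the quadratic form is `‖Sξ‖²`, while `‖Tξ‖ ≤ ‖S‖ ‖Sξ‖`. This upgrades convergence
of quadratic forms to strong convergence. -/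
lemma norm_apply_sq_le_of_nonneg {T : K →L[ℂ] K} (hT : 0 ≤ T) (ξ : K) :
    ‖T ξ‖ ^ 2 ≤ ‖T‖ * (inner ℂ (T ξ) ξ).re := by
  obtain ⟨S, rfl⟩ := CStarAlgebra.nonneg_iff_eq_star_mul_self.1 hT
  have h : (inner ℂ ((star S * S) ξ) ξ).re = ‖S ξ‖ ^ 2 := by
    rw [mul_apply_eq_comp, ContinuousLinearMap.star_eq_adjoint,
      ContinuousLinearMap.adjoint_inner_left, inner_self_eq_norm_sq_to_K]
    norm_cast
  rw [h, CStarRing.norm_star_mul_self, mul_apply_eq_comp]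
  have := (star S).le_opNorm (S ξ)
  rw [norm_star] at this
  nlinarith [norm_nonneg ((star S) (S ξ)), norm_nonneg S, norm_nonneg (S ξ)]

lemma star_mul_self_le_norm_smul_one (x : K →L[ℂ] K) :
    star x * x ≤ ((‖star x * x‖ : ℝ) : ℂ) • 1 := by
  have h := IsSelfAdjoint.le_algebraMap_norm_self (a := star x * x) (ha := .star_mul_self x)
  rw [Algebra.algebraMap_eq_smul_one] at h
  exact h

/-- Bounded increasing sequences of operators converge in the strong operator topology. -/
lemma exists_sotTendsto_of_monotone {f : ℕ → K →L[ℂ] K} (hf : Monotone f) {b : K →L[ℂ] K}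
    (hb : ∀ n, f n ≤ b) : ∃ c, SOTTendsto f atTop c := by
  refine exists_sotTendsto_of_cauchySeq fun ξ => ?_
  set r : ℕ → ℝ := fun n => (inner ℂ (f n ξ) ξ).re with hr
  have hmono : ∀ {x y : K →L[ℂ] K}, x ≤ y → (inner ℂ (x ξ) ξ).re ≤ (inner ℂ (y ξ) ξ).re := by
    intro x y h
    have := (((ContinuousLinearMap.le_def x y).1 h).re_inner_nonneg_left ξ)
    simpa [inner_sub_left] using this
  have hrc : CauchySeq r :=
    (tendsto_atTop_ciSup (fun m n h => hmono (hf h)) ⟨(inner ℂ (b ξ) ξ).re, by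
      rintro _ ⟨n, rfl⟩
      exact hmono (hb n)⟩).cauchySeq
  have hbd : ∀ m n, m ≤ n → ‖f n - f m‖ ≤ ‖b - f 0‖ := fun m n h =>
    CStarAlgebra.norm_le_norm_of_nonneg_of_le (sub_nonneg.2 (hf h))
      (sub_le_sub (hb n) (hf (Nat.zero_le m)))
  have key : ∀ m n, m ≤ n → ‖f n ξ - f m ξ‖ ^ 2 ≤ ‖b - f 0‖ * |r n - r m| := by
    intro m n h
    have h1 := norm_apply_sq_le_of_nonneg (sub_nonneg.2 (hf h)) ξ
    have h2 : (inner ℂ ((f n - f m) ξ) ξ).re = r n - r m := by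
      simp [hr]
    rw [h2] at h1
    refine h1.trans (mul_le_mul (hbd m n h) (le_abs_self _) ?_ (norm_nonneg _))
    exact sub_nonneg.2 (hmono (hf h))
  refine Metric.cauchySeq_iff'.2 fun ε hε => ?_
  have hC : 0 < ‖b - f 0‖ + 1 := by positivity
  obtain ⟨N, hN⟩ := Metric.cauchySeq_iff'.1 hrc (ε ^ 2 / (‖b - f 0‖ + 1)) (by positivity)
  refine ⟨N, fun n hn => ?_⟩
  -- The extra 1 in the tolerance for `r` keeps the divisor positive when `b = f 0`.
  have h1 := key N n hn
  have h2 := hN n hn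
  rw [Real.dist_eq, lt_div_iff₀ hC] at h2
  rw [dist_eq_norm]
  refine lt_of_pow_lt_pow_left₀ 2 hε.le ?_
  nlinarith [abs_nonneg (r n - r N)]

end Monotone

/-! ### The map `P_ω`, phases and the Choi–Effros limit. -/

section Fock

variable {H : Type u} [NormedAddCommGroup H] [InnerProductSpace ℂ H]

lemma norm_leftCreation_apply (ξ : H) (f : FockSpace H) :
    ‖leftCreation ξ f‖ = ‖ξ‖ * ‖f‖ := by
  have h := lp.hasSum_norm (p := 2) (by norm_num) (leftCreation ξ f)
  simp only [ENNReal.toReal_ofNat] at h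
  exact (Real.rpow_left_inj (norm_nonneg _) (by positivity) (by norm_num)).1
    (h.unique (hasSum_creationFun ξ f))

lemma star_leftCreation_mul_self {ξ : H} (hξ : ‖ξ‖ = 1) :
    star (leftCreation ξ) * leftCreation ξ = 1 := by
  rw [ContinuousLinearMap.star_eq_adjoint]
  exact (ContinuousLinearMap.norm_map_iff_adjoint_comp_self _).1 fun f => by
    rw [norm_leftCreation_apply, hξ, one_mul]

lemma phase_mul_leftCreation (z : Circle) (ξ : H) :
    phase z * leftCreation ξ = (z : ℂ) • (leftCreation ξ * phase z) :=
  ContinuousLinearMap.ext fun f => phase_leftCreation z ξ f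

lemma star_phase (z : Circle) : star (phase (H := H) z) = phase z⁻¹ := by
  rw [ContinuousLinearMap.star_eq_adjoint, eq_comm, ContinuousLinearMap.eq_adjoint_iff]
  intro f g
  refine (lp.hasSum_inner (𝕜 := ℂ) _ _).unique ?_
  convert! lp.hasSum_inner (𝕜 := ℂ) f (phase z g) using 2 with n
  rw [phase_apply, phase_apply, inner_smul_left, inner_smul_right, map_pow, Circle.coe_inv_eq_conj,
    Complex.conj_conj]

lemma star_leftCreation_mul_phase (z : Circle) (ξ : H) :
    star (leftCreation ξ) * phase z = (z : ℂ) • (phase z * star (leftCreation ξ)) := by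
  have h := congrArg star (phase_mul_leftCreation z⁻¹ ξ)
  rw [star_mul, star_smul, star_mul, star_phase, inv_inv, Circle.coe_inv_eq_conj] at h
  simpa using h

variable {Θ : Type w} {e : Θ → H} {ω : Θ → ℝ}

/-- The algebraic and order properties of `P_ω` are all checked term by term on this norm convergent
series. -/
lemma hasSum_fockMap (he : Orthonormal ℂ e) (hω : ∀ i, 0 < ω i) (hsum : HasSum ω 1)
    (x : FockSpace H →L[ℂ] FockSpace H) :
    HasSum (fun i => (ω i : ℂ) • (star (leftCreation (e i)) * x * leftCreation (e i)))
      (fockMap e ω x) :=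
  (Summable.of_norm (summable_fockMap he hω hsum x)).hasSum

lemma fockMap_add (he : Orthonormal ℂ e) (hω : ∀ i, 0 < ω i) (hsum : HasSum ω 1)
    (x y : FockSpace H →L[ℂ] FockSpace H) :
    fockMap e ω (x + y) = fockMap e ω x + fockMap e ω y := by
  refine (hasSum_fockMap he hω hsum _).unique ?_
  convert! (hasSum_fockMap he hω hsum x).add (hasSum_fockMap he hω hsum y) using 2 with i
  rw [← smul_add, mul_add, add_mul]

lemma fockMap_smul (he : Orthonormal ℂ e) (hω : ∀ i, 0 < ω i) (hsum : HasSum ω 1) (c : ℂ)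
    (x : FockSpace H →L[ℂ] FockSpace H) : fockMap e ω (c • x) = c • fockMap e ω x := by
  refine (hasSum_fockMap he hω hsum _).unique ?_
  convert! (hasSum_fockMap he hω hsum x).const_smul c using 2 with i
  rw [mul_smul_comm, smul_mul_assoc, smul_comm]

lemma fockMap_star (he : Orthonormal ℂ e) (hω : ∀ i, 0 < ω i) (hsum : HasSum ω 1)
    (x : FockSpace H →L[ℂ] FockSpace H) : fockMap e ω (star x) = star (fockMap e ω x) := by
  refine (hasSum_fockMap he hω hsum _).unique ?_
  convert! (hasSum_fockMap he hω hsum x).star using 2 with i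
  rw [star_smul, star_mul, star_mul, star_star, mul_assoc]
  simp

lemma fockMap_one (he : Orthonormal ℂ e) (hω : ∀ i, 0 < ω i) (hsum : HasSum ω 1) :
    fockMap e ω 1 = 1 := by
  refine (hasSum_fockMap he hω hsum _).unique ?_
  convert! (Complex.hasSum_ofReal.2 hsum).smul_const (1 : FockSpace H →L[ℂ] FockSpace H)
    using 2 with i
  · rw [mul_one, star_leftCreation_mul_self (he.1 i)]
  · simp

lemma fockMap_nonneg (he : Orthonormal ℂ e) (hω : ∀ i, 0 < ω i) (hsum : HasSum ω 1)
    {x : FockSpace H →L[ℂ] FockSpace H} (hx : 0 ≤ x) : 0 ≤ fockMap e ω x :=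
  (hasSum_fockMap he hω hsum x).nonneg fun i =>
    ofReal_smul_nonneg (hω i).le (star_left_conjugate_nonneg hx _)

lemma fockMap_mono (he : Orthonormal ℂ e) (hω : ∀ i, 0 < ω i) (hsum : HasSum ω 1) :
    Monotone (fockMap e ω) := fun x y h => by
  have := fockMap_nonneg he hω hsum (sub_nonneg.2 h)
  rwa [sub_eq_add_neg, ← neg_one_smul ℂ x, fockMap_add he hω hsum, fockMap_smul he hω hsum,
    neg_one_smul, ← sub_eq_add_neg, sub_nonneg] at this

lemma fockMap_phase_mul (he : Orthonormal ℂ e) (hω : ∀ i, 0 < ω i) (hsum : HasSum ω 1) (z : Circle)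
    (x : FockSpace H →L[ℂ] FockSpace H) :
    fockMap e ω (phase z * x) = (z : ℂ) • (phase z * fockMap e ω x) := by
  refine (hasSum_fockMap he hω hsum _).unique ?_
  convert! ((hasSum_fockMap he hω hsum x).mul_left (phase z)).const_smul (z : ℂ) using 2 with i
  rw [← mul_assoc, star_leftCreation_mul_phase]
  simp only [mul_smul_comm, smul_mul_assoc, mul_assoc]
  rw [smul_comm]

lemma fockMap_mul_phase (he : Orthonormal ℂ e) (hω : ∀ i, 0 < ω i) (hsum : HasSum ω 1) (z : Circle)
    (x : FockSpace H →L[ℂ] FockSpace H) :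
    fockMap e ω (x * phase z) = (z : ℂ) • (fockMap e ω x * phase z) := by
  refine (hasSum_fockMap he hω hsum _).unique ?_
  convert! ((hasSum_fockMap he hω hsum x).mul_right (phase z)).const_smul (z : ℂ) using 2 with i
  rw [← mul_assoc, mul_assoc _ (phase z), phase_mul_leftCreation]
  simp only [mul_smul_comm, smul_mul_assoc, mul_assoc]
  rw [smul_comm]

/-- The Kadison–Schwarz inequality at a fixed point. -/
lemma star_mul_self_le_fockMap (he : Orthonormal ℂ e) (hω : ∀ i, 0 < ω i) (hsum : HasSum ω 1)
    {x : FockSpace H →L[ℂ] FockSpace H} (hx : fockMap e ω x = x) :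
    star x * x ≤ fockMap e ω (star x * x) := by
  have hx' : fockMap e ω (star x) = star x := by rw [fockMap_star he hω hsum, hx]
  -- With `l*l = 1`, these four series are the expansion of `∑ ωᵢ (x lᵢ - lᵢ x)*(x lᵢ - lᵢ x)`, a
  -- positive operator. At a fixed point the last three sums all equal `x*x`.
  have h1 := hasSum_fockMap he hω hsum (star x * x)
  have h2 := (hasSum_fockMap he hω hsum x).mul_left (star x)
  have h3 := (hasSum_fockMap he hω hsum (star x)).mul_right x
  have h4 := (hasSum_fockMap he hω hsum 1).mul_left (star x) |>.mul_right x
  rw [hx] at h2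
  rw [hx'] at h3
  rw [fockMap_one he hω hsum, mul_one] at h4
  have h := ((h1.sub h2).sub h3).add h4
  rw [sub_add_cancel] at h
  refine sub_nonneg.1 (h.nonneg fun i => ?_)
  have hl := star_leftCreation_mul_self (he.1 i)
  set l := leftCreation (e i)
  have : 0 ≤ (ω i : ℂ) • (star (x * l - l * x) * (x * l - l * x)) :=
    ofReal_smul_nonneg (hω i).le (star_mul_self_nonneg _)
  convert this using 1
  simp only [mul_smul_comm, smul_mul_assoc, ← smul_sub, ← smul_add, star_sub, star_mul, mul_sub,
    sub_mul, mul_assoc, mul_one]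
  congr 1
  abel

lemma fockMap_iterate_add (he : Orthonormal ℂ e) (hω : ∀ i, 0 < ω i) (hsum : HasSum ω 1) (n : ℕ)
    (x y : FockSpace H →L[ℂ] FockSpace H) :
    (fockMap e ω)^[n] (x + y) = (fockMap e ω)^[n] x + (fockMap e ω)^[n] y := by
  induction n generalizing x y with
  | zero => rfl
  | succ n ih => rw [Function.iterate_succ_apply, fockMap_add he hω hsum, ih]; rfl

lemma fockMap_iterate_smul (he : Orthonormal ℂ e) (hω : ∀ i, 0 < ω i) (hsum : HasSum ω 1) (n : ℕ)
    (c : ℂ) (x : FockSpace H →L[ℂ] FockSpace H) :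
    (fockMap e ω)^[n] (c • x) = c • (fockMap e ω)^[n] x := by
  induction n generalizing x with
  | zero => rfl
  | succ n ih => rw [Function.iterate_succ_apply, fockMap_smul he hω hsum, ih]; rfl

/-- Kadison–Schwarz makes the iterates increase, and a scalar multiple of 1, fixed by `P_ω`, bounds
them. -/
lemma exists_sotTendsto_fockMap_star_mul_self (he : Orthonormal ℂ e) (hω : ∀ i, 0 < ω i)
    (hsum : HasSum ω 1) {x : FockSpace H →L[ℂ] FockSpace H} (hx : fockMap e ω x = x) :
    ∃ c, SOTTendsto (fun n => (fockMap e ω)^[n] (star x * x)) atTop c := by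
  have hmono := fockMap_mono he hω hsum
  refine exists_sotTendsto_of_monotone (b := ((‖star x * x‖ : ℝ) : ℂ) • 1)
    (monotone_nat_of_le_succ fun n => ?_) fun n => ?_
  · rw [Function.iterate_succ_apply]
    exact hmono.iterate n (star_mul_self_le_fockMap he hω hsum hx)
  · have h1 := hmono.iterate n (star_mul_self_le_norm_smul_one x)
    have h2 : fockMap e ω (((‖star x * x‖ : ℝ) : ℂ) • 1) = ((‖star x * x‖ : ℝ) : ℂ) • 1 := by
      rw [fockMap_smul he hω hsum, fockMap_one he hω hsum]
    rwa [Function.iterate_fixed h2] at h1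

/-- Polarizing with `star x` is what suits fixed points: they form a self-adjoint subspace, so each
`y + c • star x` is again fixed. -/
lemma polarization_star_mul {A : Type*} [Ring A] [StarRing A] [Algebra ℂ A] [StarModule ℂ A]
    (x y : A) :
    x * y = (4⁻¹ : ℂ) • (star (y + star x) * (y + star x))
      + (-4⁻¹ : ℂ) • (star (y + (-1 : ℂ) • star x) * (y + (-1 : ℂ) • star x))
      + (4⁻¹ * Complex.I : ℂ) •
        (star (y + Complex.I • star x) * (y + Complex.I • star x))
      + (-(4⁻¹ * Complex.I) : ℂ) •
        (star (y + (-Complex.I) • star x) * (y + (-Complex.I) • star x)) := by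
  simp only [star_add, star_smul, star_star, mul_add, add_mul, mul_smul_comm, smul_mul_assoc,
    smul_add, smul_smul]
  simp only [RCLike.star_def, map_neg, map_one, Complex.conj_I]
  ring_nf
  simp only [Complex.I_sq, Complex.I_pow_three]
  module

lemma exists_sotTendsto_fockMap_mul (he : Orthonormal ℂ e) (hω : ∀ i, 0 < ω i)
    (hsum : HasSum ω 1) {x y : FockSpace H →L[ℂ] FockSpace H} (hx : fockMap e ω x = x)
    (hy : fockMap e ω y = y) :
    ∃ c, SOTTendsto (fun n => (fockMap e ω)^[n] (x * y)) atTop c := by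
  have h : ∀ c : ℂ, ∃ d, SOTTendsto (fun n => (fockMap e ω)^[n]
      (star (y + c • star x) * (y + c • star x))) atTop d := fun c =>
    exists_sotTendsto_fockMap_star_mul_self he hω hsum (by
      rw [fockMap_add he hω hsum, fockMap_smul he hω hsum, fockMap_star he hω hsum, hx, hy])
  have hadd : ∀ {s t : FockSpace H →L[ℂ] FockSpace H},
      (∃ c, SOTTendsto (fun n => (fockMap e ω)^[n] s) atTop c) →
      (∃ c, SOTTendsto (fun n => (fockMap e ω)^[n] t) atTop c) →
      ∃ c, SOTTendsto (fun n => (fockMap e ω)^[n] (s + t)) atTop c := by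
    rintro s t ⟨c, hc⟩ ⟨d, hd⟩
    refine ⟨c + d, fun ξ => ?_⟩
    simp_rw [fockMap_iterate_add he hω hsum]
    exact (hc ξ).add (hd ξ)
  have hsmul : ∀ (r : ℂ) {s : FockSpace H →L[ℂ] FockSpace H},
      (∃ c, SOTTendsto (fun n => (fockMap e ω)^[n] s) atTop c) →
      ∃ c, SOTTendsto (fun n => (fockMap e ω)^[n] (r • s)) atTop c := by
    rintro r s ⟨c, hc⟩
    refine ⟨r • c, fun ξ => ?_⟩
    simp_rw [fockMap_iterate_smul he hω hsum]
    exact (hc ξ).const_smul r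
  have h1 := h 1
  rw [one_smul] at h1
  rw [polarization_star_mul x y]
  exact hadd (hadd (hadd (hsmul _ h1) (hsmul _ (h _))) (hsmul _ (h _))) (hsmul _ (h _))

/-- `choiEffros` defaults to 0, so it represents the limit only once existence is known. -/
lemma sotTendsto_choiEffros {K : Type*} [NormedAddCommGroup K] [InnerProductSpace ℂ K]
    {τ : (K →L[ℂ] K) → (K →L[ℂ] K)} {x y : K →L[ℂ] K}
    (h : ∃ c, SOTTendsto (fun n : ℕ => τ^[n] (x * y)) atTop c) :
    SOTTendsto (fun n : ℕ => τ^[n] (x * y)) atTop (choiEffros τ x y) := by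
  rw [choiEffros, dif_pos h]
  exact h.choose_spec

lemma fockMap_iterate_phase_mul_mul_phase (he : Orthonormal ℂ e) (hω : ∀ i, 0 < ω i)
    (hsum : HasSum ω 1) (z w : Circle) (x : FockSpace H →L[ℂ] FockSpace H) (n : ℕ) :
    (fockMap e ω)^[n] (phase z * x * phase w) =
      ((z : ℂ) * w) ^ n • (phase z * (fockMap e ω)^[n] x * phase w) := by
  induction n with
  | zero => simp
  | succ n ih =>
    rw [Function.iterate_succ_apply', ih, fockMap_smul he hω hsum, fockMap_mul_phase he hω hsum,
      fockMap_phase_mul he hω hsum, Function.iterate_succ_apply', smul_mul_assoc, smul_smul,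
      smul_smul]
    congr 1
    ring

end Fock

/-! ### Recurrence on the torus, and closure properties of von Neumann algebras. -/

/-- The points of `S` form one element of the compact group `Circle^S`, and the powers of any
element of a compact group cluster at the identity. -/
lemma frequently_forall_norm_pow_sub_one_lt (S : Finset Circle) {ε : ℝ} (hε : 0 < ε) :
    ∃ᶠ n in (atTop : Filter ℕ), ∀ z ∈ S, ‖(z : ℂ) ^ n - 1‖ < ε := by
  have h := mapClusterPt_one_atTop_pow (fun z : S => (z : Circle))
  have hc : Continuous fun f : S → Circle => fun z : S => ((f z : Circle) : ℂ) := by fun_prop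
  have hU : {f : S → Circle | ∀ z, ‖(f z : ℂ) - 1‖ < ε} ∈ 𝓝 (1 : S → Circle) := by
    have : IsOpen {f : S → Circle | ∀ z, ‖(f z : ℂ) - 1‖ < ε} := by
      simp only [Set.ofPred_forall]
      exact isOpen_iInter_of_finite fun z => isOpen_lt (by fun_prop) continuous_const
    exact this.mem_nhds (by simp [hε])
  refine (h.frequently hU).mono fun n hn z hz => ?_
  simpa using hn ⟨z, hz⟩

lemma eigenspace_subset_peripheralPoissonBoundary {R : Type*} [AddCommGroup R] [Module ℂ R]
    [TopologicalSpace R] {τ : R → R} {x : R} {z : Circle} (h : τ x = (z : ℂ) • x) :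
    x ∈ peripheralPoissonBoundary τ :=
  subset_closure (Submodule.subset_span (Set.mem_iUnion.2 ⟨z, h⟩))

/-- Commuting with a fixed operator survives strong limits, so the bicommutant is strongly closed.
-/
lemma mem_vonNeumannAlgebra_of_sotTendsto {K : Type*} [NormedAddCommGroup K]
    [InnerProductSpace ℂ K] [CompleteSpace K] (M : VonNeumannAlgebra K) {f : ℕ → K →L[ℂ] K}
    {c : K →L[ℂ] K} (h : SOTTendsto f atTop c) (hf : ∀ n, f n ∈ M.toStarSubalgebra) :
    c ∈ M.toStarSubalgebra := by
  change c ∈ (M : Set (K →L[ℂ] K))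
  rw [← M.centralizer_centralizer, Set.mem_centralizer_iff]
  intro y hy
  refine (h.mul_left y).unique ?_
  convert! h.mul_right y using 2 with n
  exact (hy (f n) (hf n)).symm

lemma isClosed_vonNeumannAlgebra {K : Type*} [NormedAddCommGroup K]
    [InnerProductSpace ℂ K] [CompleteSpace K] (M : VonNeumannAlgebra K) :
    IsClosed (M.toStarSubalgebra : Set (K →L[ℂ] K)) := by
  rw [VonNeumannAlgebra.coe_toStarSubalgebra, ← M.centralizer_centralizer]
  exact Set.isClosed_centralizer _

/-! ### Corner embedding and compression of a dilation. -/

namespace MinimalDilation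

variable {G : Type u} [NormedAddCommGroup G] [InnerProductSpace ℂ G] [CompleteSpace G]
  {τ : (G →L[ℂ] G) → (G →L[ℂ] G)} (D : MinimalDilation.{u, v} τ)

/-- The von Neumann algebra of a dilation, as a type. -/
abbrev Alg : Type v := D.𝓑.toStarSubalgebra

/-- The embedding of `B(G)` as a corner of the algebra of a dilation. -/
def corner (x : G →L[ℂ] G) : D.Alg := ⟨_, D.corner_mem x⟩

lemma corner_apply (x : G →L[ℂ] G) (ξ : D.K) :
    (D.corner x : D.K →L[ℂ] D.K) ξ =
      D.V (x (ContinuousLinearMap.adjoint D.V.toContinuousLinearMap ξ)) := rfl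

lemma compression_apply (z : D.Alg) (h : G) : D.compression z h =
    ContinuousLinearMap.adjoint D.V.toContinuousLinearMap ((z : D.K →L[ℂ] D.K) (D.V h)) := rfl

lemma adjoint_V_apply (h : G) :
    ContinuousLinearMap.adjoint D.V.toContinuousLinearMap (D.V h) = h := by
  have := (ContinuousLinearMap.norm_map_iff_adjoint_comp_self D.V.toContinuousLinearMap).1
    D.V.norm_map
  exact DFunLike.congr_fun this h

lemma alg_ext {z w : D.Alg} (h : ∀ ξ, (z : D.K →L[ℂ] D.K) ξ = (w : D.K →L[ℂ] D.K) ξ) : z = w :=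
  Subtype.ext (ContinuousLinearMap.ext h)

lemma corner_mul (x y : G →L[ℂ] G) : D.corner (x * y) = D.corner x * D.corner y :=
  D.alg_ext fun ξ => by
    change _ = (D.corner x : D.K →L[ℂ] D.K) ((D.corner y : D.K →L[ℂ] D.K) ξ)
    simp only [corner_apply, adjoint_V_apply]
    rfl

lemma corner_smul (c : ℂ) (x : G →L[ℂ] G) : D.corner (c • x) = c • D.corner x :=
  D.alg_ext fun ξ => by
    change _ = c • (D.corner x : D.K →L[ℂ] D.K) ξ
    rw [corner_apply, corner_apply, ← map_smul]
    rfl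

lemma compression_corner (x : G →L[ℂ] G) : D.compression (D.corner x) = x :=
  ContinuousLinearMap.ext fun h => by
    rw [compression_apply, corner_apply, adjoint_V_apply, adjoint_V_apply]

lemma corner_one_mul_mul_corner_one (z : D.Alg) :
    D.corner 1 * z * D.corner 1 = D.corner (D.compression z) := rfl

lemma star_corner (x : G →L[ℂ] G) : star (D.corner x) = D.corner (star x) := by
  apply Subtype.ext
  change ContinuousLinearMap.adjoint (D.V.toContinuousLinearMap ∘L x ∘L
    ContinuousLinearMap.adjoint D.V.toContinuousLinearMap) = D.V.toContinuousLinearMap ∘L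
    ContinuousLinearMap.adjoint x ∘L ContinuousLinearMap.adjoint D.V.toContinuousLinearMap
  rw [ContinuousLinearMap.adjoint_comp, ContinuousLinearMap.adjoint_comp,
    ContinuousLinearMap.adjoint_adjoint, ContinuousLinearMap.comp_assoc]

lemma compression_theta_iterate_corner (n : ℕ) (x : G →L[ℂ] G) :
    D.compression (D.θ^[n] (D.corner x)) = τ^[n] x := D.dilates n x

lemma norm_V_le : ‖D.V.toContinuousLinearMap‖ ≤ 1 := D.V.norm_toContinuousLinearMap_le

lemma norm_adjoint_V_le : ‖ContinuousLinearMap.adjoint D.V.toContinuousLinearMap‖ ≤ 1 := by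
  rw [LinearIsometryEquiv.norm_map]
  exact D.norm_V_le

lemma norm_corner_le (x : G →L[ℂ] G) : ‖D.corner x‖ ≤ ‖x‖ := by
  refine (ContinuousLinearMap.opNorm_comp_le _ _).trans ?_
  refine (mul_le_of_le_one_left (norm_nonneg _) D.norm_V_le).trans ?_
  refine (ContinuousLinearMap.opNorm_comp_le _ _).trans ?_
  exact mul_le_of_le_one_right (norm_nonneg _) D.norm_adjoint_V_le

lemma norm_compression_le (z : D.Alg) : ‖D.compression z‖ ≤ ‖z‖ := by
  refine (ContinuousLinearMap.opNorm_comp_le _ _).trans ?_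
  refine (mul_le_of_le_one_left (norm_nonneg _) D.norm_adjoint_V_le).trans ?_
  refine (ContinuousLinearMap.opNorm_comp_le _ _).trans ?_
  exact mul_le_of_le_one_right (norm_nonneg _) D.norm_V_le

lemma norm_theta_iterate_le (n : ℕ) (z : D.Alg) : ‖D.θ^[n] z‖ ≤ ‖z‖ := by
  induction n generalizing z with
  | zero => rfl
  | succ n ih =>
    -- Norm closedness makes the algebra a C⋆-algebra, where star homomorphisms are contractive.
    have := isClosed_vonNeumannAlgebra D.𝓑
    exact (ih _).trans (NonUnitalStarAlgHom.norm_apply_le D.θ z)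

/-- The compression as a bounded linear map. -/
def compressionCLM : D.Alg →L[ℂ] (G →L[ℂ] G) :=
  LinearMap.mkContinuous
    { toFun := D.compression
      map_add' := fun z w => ContinuousLinearMap.ext fun h => by
        rw [add_apply, compression_apply, compression_apply, compression_apply, ← map_add]
        rfl
      map_smul' := fun c z => ContinuousLinearMap.ext fun h => by
        rw [smul_apply, compression_apply, compression_apply, ← map_smul]
        rfl } 1 fun z => by simpa using D.norm_compression_le z

lemma theta_iterate_smul (n : ℕ) (c : ℂ) (z : D.Alg) : D.θ^[n] (c • z) = c • D.θ^[n] z := by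
  induction n generalizing z with
  | zero => rfl
  | succ n ih => rw [Function.iterate_succ_apply, map_smul, ih]; rfl

lemma theta_iterate_star (n : ℕ) (z : D.Alg) : D.θ^[n] (star z) = star (D.θ^[n] z) := by
  induction n generalizing z with
  | zero => rfl
  | succ n ih => rw [Function.iterate_succ_apply, map_star, ih]; rfl

/-! ### The filtration `θⁿ(p)` and its convergence to 1. -/

/-- The increasing projections `θⁿ(p)`. -/
def proj (n : ℕ) : D.Alg := D.θ^[n] (D.corner 1)

lemma proj_zero_apply_V (h : G) : (D.proj 0 : D.K →L[ℂ] D.K) (D.V h) = D.V h := by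
  change (D.corner 1 : D.K →L[ℂ] D.K) (D.V h) = D.V h
  rw [corner_apply, adjoint_V_apply]
  rfl

lemma proj_mul_self (n : ℕ) : D.proj n * D.proj n = D.proj n := by
  rw [proj, ← iterate_map_mul, ← corner_mul, mul_one]

lemma star_proj (n : ℕ) : star (D.proj n) = D.proj n := by
  rw [proj, ← theta_iterate_star, star_corner, star_one]

lemma norm_proj_le (n : ℕ) : ‖D.proj n‖ ≤ 1 :=
  (D.norm_theta_iterate_le n _).trans ((D.norm_corner_le 1).trans ContinuousLinearMap.norm_id_le)

/-- This is `p ≤ θ(p)`. Unitality of `τ` gives `⟪Vh, θ(p)Vh⟫ = ‖Vh‖²`, and a contraction can attain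
this only by fixing `Vh`. -/
lemma proj_one_apply_V (hτ : τ 1 = 1) (h : G) :
    (D.proj 1 : D.K →L[ℂ] D.K) (D.V h) = D.V h := by
  have h1 : ContinuousLinearMap.adjoint D.V.toContinuousLinearMap
      ((D.proj 1 : D.K →L[ℂ] D.K) (D.V h)) = h := by
    have := D.compression_theta_iterate_corner 1 1
    rw [Function.iterate_one τ, hτ] at this
    exact DFunLike.congr_fun this h
  have hn : ‖(D.proj 1 : D.K →L[ℂ] D.K) (D.V h)‖ ≤ ‖D.V h‖ :=
    ContinuousLinearMap.le_of_opNorm_le_of_le _ (D.norm_proj_le 1) le_rfl |>.trans (by simp)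
  have hi : Inner.inner ℂ (D.V h) ((D.proj 1 : D.K →L[ℂ] D.K) (D.V h)) = ((‖D.V h‖ ^ 2 : ℝ) : ℂ) := by
    rw [← LinearIsometry.coe_toContinuousLinearMap, ← ContinuousLinearMap.adjoint_inner_right,
      LinearIsometry.coe_toContinuousLinearMap, h1, inner_self_eq_norm_sq_to_K, D.V.norm_map]
    norm_cast
  rw [← sub_eq_zero, ← norm_eq_zero, ← sq_eq_zero_iff]
  have := norm_sub_sq (𝕜 := ℂ) (D.V h) ((D.proj 1 : D.K →L[ℂ] D.K) (D.V h))
  rw [hi] at this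
  rw [norm_sub_rev, this]
  refine le_antisymm ?_ (this ▸ sq_nonneg _)
  simp only [RCLike.re_to_complex, Complex.ofReal_re]
  nlinarith [norm_nonneg ((D.proj 1 : D.K →L[ℂ] D.K) (D.V h))]

lemma proj_one_mul_proj_zero (hτ : τ 1 = 1) : D.proj 1 * D.proj 0 = D.proj 0 :=
  D.alg_ext fun _ => D.proj_one_apply_V hτ _

lemma proj_mul_proj (hτ : τ 1 = 1) {m n : ℕ} (h : m ≤ n) : D.proj n * D.proj m = D.proj m := by
  induction n, h using Nat.le_induction with
  | base => exact D.proj_mul_self m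
  | succ n h ih =>
    have h1 : D.proj (n + 1) * D.proj n = D.proj n := by
      have := congrArg D.θ^[n] (D.proj_one_mul_proj_zero hτ)
      rw [iterate_map_mul] at this
      exact this
    rw [← ih, ← mul_assoc, h1]

lemma proj_mul_proj' (hτ : τ 1 = 1) {m n : ℕ} (h : m ≤ n) : D.proj m * D.proj n = D.proj m := by
  have := congrArg star (D.proj_mul_proj hτ h)
  rwa [star_mul, star_proj, star_proj] at this

lemma proj_mul_theta_iterate_corner (hτ : τ 1 = 1) {m n : ℕ} (h : m ≤ n) (x : G →L[ℂ] G) :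
    D.proj n * D.θ^[m] (D.corner x) = D.θ^[m] (D.corner x) := by
  have h1 : D.θ^[m] (D.corner x) = D.proj m * D.θ^[m] (D.corner x) := by
    rw [proj, ← iterate_map_mul, ← corner_mul, one_mul]
  rw [h1, ← mul_assoc, D.proj_mul_proj hτ h]

lemma proj_apply_V (hτ : τ 1 = 1) (n : ℕ) (h : G) :
    (D.proj n : D.K →L[ℂ] D.K) (D.V h) = D.V h := by
  have h1 := D.proj_mul_proj hτ (Nat.zero_le n)
  have h2 := congrArg (fun z : D.Alg => (z : D.K →L[ℂ] D.K) (D.V h)) h1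
  change (D.proj n : D.K →L[ℂ] D.K) ((D.proj 0 : D.K →L[ℂ] D.K) (D.V h)) =
    (D.proj 0 : D.K →L[ℂ] D.K) (D.V h) at h2
  rwa [proj_zero_apply_V] at h2

/-- Minimality enters here. A spanning vector with leftmost factor `θᵐ(x)` lies in the range of
`pₘ`, hence is fixed by all later `pₙ`; density and `‖pₙ‖ ≤ 1` do the rest. -/
lemma sotTendsto_proj (hτ : τ 1 = 1) :
    SOTTendsto (fun n => (D.proj n : D.K →L[ℂ] D.K)) atTop 1 := by
  set W : Submodule ℂ D.K := Submodule.span ℂ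
    {ξ : D.K | ∃ (L : List (ℕ × (G →L[ℂ] G))) (h : G),
      ξ = (L.map fun q => (D.θ^[q.1] (D.corner q.2) : D.K →L[ℂ] D.K)).prod (D.V h)} with hW
  have hWd : Dense (W : Set D.K) := Submodule.dense_iff_topologicalClosure_eq_top.2 D.total
  have hev : ∀ ξ ∈ W, ∃ N, ∀ n ≥ N, (D.proj n : D.K →L[ℂ] D.K) ξ = ξ := by
    intro ξ hξ
    induction hξ using Submodule.span_induction with
    | mem ξ hξ =>
      obtain ⟨L, h, rfl⟩ := hξ
      cases L with
      | nil => exact ⟨0, fun n _ => D.proj_apply_V hτ n h⟩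
      | cons q L =>
        refine ⟨q.1, fun n hn => ?_⟩
        rw [List.map_cons, List.prod_cons]
        exact congrArg (fun z : D.Alg => (z : D.K →L[ℂ] D.K)
          ((L.map fun q => (D.θ^[q.1] (D.corner q.2) : D.K →L[ℂ] D.K)).prod (D.V h)))
          (D.proj_mul_theta_iterate_corner hτ hn q.2)
    | zero => exact ⟨0, fun n _ => map_zero _⟩
    | add ξ η _ _ h1 h2 =>
      obtain ⟨N, hN⟩ := h1
      obtain ⟨M, hM⟩ := h2
      refine ⟨max N M, fun n hn => ?_⟩
      rw [map_add, hN n (le_of_max_le_left hn), hM n (le_of_max_le_right hn)]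
    | smul c ξ _ h1 =>
      obtain ⟨N, hN⟩ := h1
      exact ⟨N, fun n hn => by rw [map_smul, hN n hn]⟩
  intro ξ
  rw [Metric.tendsto_atTop]
  intro ε hε
  obtain ⟨η, hη, hd⟩ := Metric.mem_closure_iff.1 (hWd ξ) (ε / 2) (by positivity)
  obtain ⟨N, hN⟩ := hev η hη
  refine ⟨N, fun n hn => ?_⟩
  have h1 : dist ((D.proj n : D.K →L[ℂ] D.K) ξ) η ≤ dist ξ η := by
    rw [dist_eq_norm, dist_eq_norm]
    conv_lhs => rw [← hN n hn, ← map_sub]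
    exact ContinuousLinearMap.le_of_opNorm_le_of_le _ (D.norm_proj_le n) le_rfl |>.trans (by simp)
  calc dist ((D.proj n : D.K →L[ℂ] D.K) ξ) ξ ≤ dist ((D.proj n : D.K →L[ℂ] D.K) ξ) η + dist η ξ :=
        dist_triangle _ _ _
    _ < ε := by rw [dist_comm η ξ]; linarith

lemma corner_injective : Function.Injective D.corner :=
  Function.LeftInverse.injective D.compression_corner

lemma proj_zero_mul_mul (z : D.Alg) : D.proj 0 * z * D.proj 0 = D.corner (D.compression z) := rfl

lemma proj_mul_theta_iterate_mul (n : ℕ) (z : D.Alg) :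
    D.proj n * D.θ^[n] z * D.proj n = D.θ^[n] (D.corner (D.compression z)) := by
  rw [proj, ← iterate_map_mul, ← iterate_map_mul, corner_one_mul_mul_corner_one]

/-- Since `p ≤ θ(p)`, one may insert `θ(p)` on both sides: `p θ(z) p = p θ(pzp) p`, and the dilation
property applies to `pzp`. -/
lemma compression_theta (hτ : τ 1 = 1) (z : D.Alg) :
    D.compression (D.θ z) = τ (D.compression z) := by
  apply D.corner_injective
  have h1 := D.proj_mul_theta_iterate_mul 1 z
  rw [Function.iterate_one D.θ] at h1
  have h2 := D.proj_one_mul_proj_zero hτ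
  have h3 := D.proj_mul_proj' hτ (Nat.zero_le 1)
  have h4 := D.compression_theta_iterate_corner 1 (D.compression z)
  rw [Function.iterate_one τ, Function.iterate_one D.θ] at h4
  rw [← h4, ← h1, ← proj_zero_mul_mul, ← proj_zero_mul_mul]
  calc D.proj 0 * D.θ z * D.proj 0
      = (D.proj 0 * D.proj 1) * D.θ z * (D.proj 1 * D.proj 0) := by rw [h2, h3]
    _ = _ := by simp only [mul_assoc]

lemma compression_eigen (hτ : τ 1 = 1) {z : D.Alg} {c : ℂ} (h : D.θ z = c • z) :
    τ (D.compression z) = c • D.compression z := by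
  rw [← D.compression_theta hτ, h]
  exact D.compressionCLM.map_smul c z

/-! ### Compression is isometric on the peripheral boundary of `θ`. -/

/-- The peripheral Poisson boundary of `θ`, as a closed subspace. -/
def boundary : Submodule ℂ D.Alg :=
  (Submodule.span ℂ (⋃ z : Circle, peripheralEigenspace D.θ z)).topologicalClosure

lemma mapsTo_compression (hτ : τ 1 = 1) :
    Set.MapsTo D.compression (peripheralPoissonBoundary D.θ) (peripheralPoissonBoundary τ) := by
  have h : Set.MapsTo D.compressionCLM
      (Submodule.span ℂ (⋃ z : Circle, peripheralEigenspace D.θ z) : Set D.Alg)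
      (Submodule.span ℂ (⋃ z : Circle, peripheralEigenspace τ z) : Set (G →L[ℂ] G)) := by
    intro z hz
    have : Submodule.span ℂ (⋃ z : Circle, peripheralEigenspace D.θ z) ≤
        (Submodule.span ℂ (⋃ z : Circle, peripheralEigenspace τ z)).comap
          (D.compressionCLM : D.Alg →ₗ[ℂ] (G →L[ℂ] G)) := by
      rw [Submodule.span_le]
      intro x hx
      obtain ⟨c, hc⟩ := Set.mem_iUnion.1 hx
      exact Submodule.subset_span (Set.mem_iUnion.2 ⟨c, D.compression_eigen hτ hc⟩)
    exact this hz
  exact h.closure D.compressionCLM.continuous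

lemma theta_iterate_eigen {z : D.Alg} {c : ℂ} (h : D.θ z = c • z) (n : ℕ) :
    D.θ^[n] z = c ^ n • z := by
  induction n with
  | zero => simp
  | succ n ih => rw [Function.iterate_succ_apply', ih, map_smul, h, smul_smul, ← pow_succ]

/-- Elements in the span of the peripheral eigenvectors are almost periodic under `θ`. -/
lemma norm_theta_iterate_sub_le {z : D.Alg}
    (hz : z ∈ Submodule.span ℂ (⋃ z : Circle, peripheralEigenspace D.θ z)) :
    ∃ (S : Finset Circle) (C : ℝ), 0 ≤ C ∧ ∀ (n : ℕ) (ε : ℝ), 0 ≤ ε →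
      (∀ c ∈ S, ‖(c : ℂ) ^ n - 1‖ < ε) → ‖D.θ^[n] z - z‖ ≤ C * ε := by
  classical
  induction hz using Submodule.span_induction with
  | mem z hz =>
    obtain ⟨c, hc⟩ := Set.mem_iUnion.1 hz
    refine ⟨{c}, ‖z‖, norm_nonneg _, fun n ε hε h => ?_⟩
    have h2 : D.θ^[n] z - z = ((c : ℂ) ^ n - 1) • z := by
      rw [D.theta_iterate_eigen hc, sub_smul, one_smul]
    rw [h2, norm_smul, mul_comm]
    exact mul_le_mul_of_nonneg_left (h c (Finset.mem_singleton_self c)).le (norm_nonneg _)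
  | zero => exact ⟨∅, 0, le_rfl, fun n ε _ _ => by rw [iterate_map_zero]; simp⟩
  | add x y _ _ hx hy =>
    obtain ⟨S, C, hC, h1⟩ := hx
    obtain ⟨S', C', hC', h2⟩ := hy
    refine ⟨S ∪ S', C + C', add_nonneg hC hC', fun n ε hε h => ?_⟩
    rw [iterate_map_add, add_sub_add_comm, add_mul]
    exact (norm_add_le _ _).trans (add_le_add
      (h1 n ε hε fun c hc => h c (Finset.mem_union_left _ hc))
      (h2 n ε hε fun c hc => h c (Finset.mem_union_right _ hc)))
  | smul r x _ hx =>
    obtain ⟨S, C, hC, h1⟩ := hx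
    refine ⟨S, ‖r‖ * C, mul_nonneg (norm_nonneg _) hC, fun n ε hε h => ?_⟩
    rw [theta_iterate_smul, ← smul_sub, norm_smul, mul_assoc]
    exact mul_le_mul_of_nonneg_left (h1 n ε hε h) (norm_nonneg _)

lemma tendsto_proj_mul_mul_proj (hτ : τ 1 = 1) (z : D.Alg) (ξ : D.K) :
    Tendsto (fun n => ((D.proj n * z * D.proj n : D.Alg) : D.K →L[ℂ] D.K) ξ) atTop
      (𝓝 ((z : D.K →L[ℂ] D.K) ξ)) := by
  have h1 := D.sotTendsto_proj hτ
  have h2 : Tendsto (fun n => (z : D.K →L[ℂ] D.K) ((D.proj n : D.K →L[ℂ] D.K) ξ) -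
      (z : D.K →L[ℂ] D.K) ξ) atTop (𝓝 0) := by
    rw [← sub_self ((z : D.K →L[ℂ] D.K) ξ)]
    exact (((z : D.K →L[ℂ] D.K).continuous.tendsto _).comp (h1 ξ)).sub_const _
  have h3 : Tendsto (fun n => (D.proj n : D.K →L[ℂ] D.K)
      ((z : D.K →L[ℂ] D.K) ((D.proj n : D.K →L[ℂ] D.K) ξ) - (z : D.K →L[ℂ] D.K) ξ)) atTop
      (𝓝 0) := by
    refine squeeze_zero_norm (fun n => ?_) (tendsto_zero_iff_norm_tendsto_zero.1 h2)
    exact ContinuousLinearMap.le_of_opNorm_le_of_le _ (D.norm_proj_le n) le_rfl |>.trans (by simp)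
  have h4 := h3.add (h1 ((z : D.K →L[ℂ] D.K) ξ))
  rw [zero_add] at h4
  refine h4.congr fun n => ?_
  rw [map_sub, sub_add_cancel]
  rfl

/-- When `θⁿ(z)` is close to `z`, the corner `pₙ z pₙ` is close to `pₙ θⁿ(z) pₙ = θⁿ(pzp)`, of norm
at most `‖pzp‖`; and `pₙ z pₙ` tends strongly to `z`. -/
lemma norm_le_norm_compression_of_mem_span (hτ : τ 1 = 1) {z : D.Alg}
    (hz : z ∈ Submodule.span ℂ (⋃ z : Circle, peripheralEigenspace D.θ z)) :
    ‖z‖ ≤ ‖D.compression z‖ := by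
  obtain ⟨S, C, hC, hS⟩ := D.norm_theta_iterate_sub_le hz
  refine le_of_forall_pos_le_add fun ε hε => ?_
  refine ContinuousLinearMap.opNorm_le_bound _ (by positivity) fun ξ => ?_
  -- A bound along infinitely many `n` passes to the limit, so recurrence suffices. The tolerance `ε
  -- / (C + 1)` allows `C = 0`.
  refine le_of_tendsto_of_frequently (D.tendsto_proj_mul_mul_proj hτ z ξ).norm
    ((frequently_forall_norm_pow_sub_one_lt S (ε := ε / (C + 1)) (by positivity)).mono
      fun n hn => ?_)
  refine ContinuousLinearMap.le_of_opNorm_le _ ?_ ξ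
  have h1 := hS n _ (by positivity) hn
  have h2 : C * (ε / (C + 1)) ≤ ε := by
    rw [mul_div_assoc', div_le_iff₀ (by positivity)]
    nlinarith
  have h3 : D.proj n * z * D.proj n = D.θ^[n] (D.corner (D.compression z)) -
      D.proj n * (D.θ^[n] z - z) * D.proj n := by
    rw [← proj_mul_theta_iterate_mul]
    noncomm_ring
  change ‖D.proj n * z * D.proj n‖ ≤ _
  rw [h3]
  refine (norm_sub_le _ _).trans (add_le_add
    ((D.norm_theta_iterate_le n _).trans (D.norm_corner_le _)) ?_)
  have h4 : ‖D.proj n * (D.θ^[n] z - z)‖ ≤ ε :=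
    (norm_mul_le _ _).trans ((mul_le_of_le_one_left (norm_nonneg _) (D.norm_proj_le n)).trans
      (h1.trans h2))
  exact (norm_mul_le _ _).trans
    ((mul_le_of_le_one_right (norm_nonneg _) (D.norm_proj_le n)).trans h4)

/-- The compression is isometric on the peripheral Poisson boundary of `θ`. -/
lemma norm_le_norm_compression (hτ : τ 1 = 1) {z : D.Alg}
    (hz : z ∈ peripheralPoissonBoundary D.θ) : ‖z‖ ≤ ‖D.compression z‖ := by
  have hcl : IsClosed {z : D.Alg | ‖z‖ ≤ ‖D.compressionCLM z‖} :=
    isClosed_le continuous_norm D.compressionCLM.continuous.norm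
  exact closure_minimal (fun w hw => D.norm_le_norm_compression_of_mem_span hτ hw) hcl hz

lemma injOn_compression (hτ : τ 1 = 1) :
    Set.InjOn D.compression (peripheralPoissonBoundary D.θ) := by
  intro x hx y hy h
  rw [← sub_eq_zero, ← norm_le_zero_iff]
  refine (D.norm_le_norm_compression hτ (D.boundary.sub_mem hx hy)).trans ?_
  have : D.compression (x - y) = D.compression x - D.compression y := D.compressionCLM.map_sub x y
  rw [this, h, sub_self, norm_zero]

/-! ### Lifting eigenvectors of `τ` to eigenvectors of `θ`. -/

/-- `τ` is a bare function here; it inherits homogeneity from being corner embedding, then `θ`, then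
compression. -/
lemma map_smul_of_dilation (D : MinimalDilation.{u, v} τ) (hτ : τ 1 = 1) (c : ℂ) (x : G →L[ℂ] G) : τ (c • x) = c • τ x := by
  have h := fun y : G →L[ℂ] G => D.compression_theta hτ (D.corner y)
  simp only [compression_corner] at h
  rw [← h, ← h, corner_smul, map_smul]
  exact D.compressionCLM.map_smul c _

lemma iterate_eigen_of_dilation (D : MinimalDilation.{u, v} τ) (hτ : τ 1 = 1) {c : ℂ}
    {x : G →L[ℂ] G} (hx : τ x = c • x) (n : ℕ) :
    τ^[n] x = c ^ n • x := by
  induction n with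
  | zero => simp
  | succ n ih =>
    rw [Function.iterate_succ_apply', ih, D.map_smul_of_dilation hτ, hx, smul_smul, ← pow_succ]

/-- The sequence `c⁻ⁿ θⁿ(x)`, which converges to the lift of an eigenvector `x`. -/
def liftSeq (c : Circle) (x : G →L[ℂ] G) (n : ℕ) : D.Alg :=
  ((c : ℂ) ^ n)⁻¹ • D.θ^[n] (D.corner x)

lemma norm_liftSeq_le (c : Circle) (x : G →L[ℂ] G) (n : ℕ) : ‖D.liftSeq c x n‖ ≤ ‖x‖ := by
  rw [liftSeq, norm_smul, norm_inv, norm_pow, Circle.norm_coe, one_pow, inv_one, one_mul]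
  exact (D.norm_theta_iterate_le n _).trans (D.norm_corner_le x)

/-- The martingale property: `pₙ θᵐ(x) pₙ = θⁿ(τᵐ⁻ⁿ(x)) = cᵐ⁻ⁿ θⁿ(x)`. -/
lemma proj_mul_liftSeq_mul_proj (hτ : τ 1 = 1) {c : Circle} {x : G →L[ℂ] G}
    (hx : τ x = (c : ℂ) • x) {n m : ℕ} (h : n ≤ m) :
    D.proj n * D.liftSeq c x m * D.proj n = D.liftSeq c x n := by
  obtain ⟨k, rfl⟩ := Nat.exists_eq_add_of_le h
  have h0 : (c : ℂ) ≠ 0 := c.coe_ne_zero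
  rw [liftSeq, Function.iterate_add_apply, mul_smul_comm, smul_mul_assoc,
    proj_mul_theta_iterate_mul, compression_theta_iterate_corner,
    D.iterate_eigen_of_dilation hτ hx, corner_smul, theta_iterate_smul, smul_smul, liftSeq]
  congr 1
  field_simp
  ring

lemma norm_sub_proj_sq (n : ℕ) (v : D.K) :
    ‖v - (D.proj n : D.K →L[ℂ] D.K) v‖ ^ 2 =
      ‖v‖ ^ 2 - ‖(D.proj n : D.K →L[ℂ] D.K) v‖ ^ 2 := by
  have h1 : Inner.inner ℂ v ((D.proj n : D.K →L[ℂ] D.K) v) =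
      ((‖(D.proj n : D.K →L[ℂ] D.K) v‖ ^ 2 : ℝ) : ℂ) := by
    have h2 : ContinuousLinearMap.adjoint (D.proj n : D.K →L[ℂ] D.K) = D.proj n :=
      congrArg Subtype.val (D.star_proj n)
    have h3 : (D.proj n : D.K →L[ℂ] D.K) v =
        (D.proj n : D.K →L[ℂ] D.K) ((D.proj n : D.K →L[ℂ] D.K) v) :=
      congrArg (fun z : D.Alg => (z : D.K →L[ℂ] D.K) v) (D.proj_mul_self n).symm
    rw [h3, ← ContinuousLinearMap.adjoint_inner_left, h2, ← h3, inner_self_eq_norm_sq_to_K]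
    norm_cast
  rw [norm_sub_sq (𝕜 := ℂ), h1]
  simp only [RCLike.re_to_complex, Complex.ofReal_re]
  ring

/-- The Hilbert space martingale argument: on the range of `pₖ`, `pₙ` sends later terms to the
`n`-th one, so by Pythagoras squared increments are differences of squared norms, which increase and
are bounded. -/
lemma cauchySeq_liftSeq_proj (hτ : τ 1 = 1) {c : Circle} {x : G →L[ℂ] G}
    (hx : τ x = (c : ℂ) • x) (k : ℕ) (ξ : D.K) (hξ : (D.proj k : D.K →L[ℂ] D.K) ξ = ξ) :
    CauchySeq fun n => (D.liftSeq c x n : D.K →L[ℂ] D.K) ξ := by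
  have hfix : ∀ n, k ≤ n → (D.proj n : D.K →L[ℂ] D.K) ξ = ξ := by
    intro n hn
    have := congrArg (fun z : D.Alg => (z : D.K →L[ℂ] D.K) ξ) (D.proj_mul_proj hτ hn)
    change (D.proj n : D.K →L[ℂ] D.K) ((D.proj k : D.K →L[ℂ] D.K) ξ) =
      (D.proj k : D.K →L[ℂ] D.K) ξ at this
    rwa [hξ] at this
  have hproj : ∀ n m, k ≤ n → n ≤ m → (D.proj n : D.K →L[ℂ] D.K)
      ((D.liftSeq c x m : D.K →L[ℂ] D.K) ξ) = (D.liftSeq c x n : D.K →L[ℂ] D.K) ξ := by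
    intro n m hn hm
    have := congrArg (fun z : D.Alg => (z : D.K →L[ℂ] D.K) ξ)
      (D.proj_mul_liftSeq_mul_proj hτ hx hm)
    change (D.proj n : D.K →L[ℂ] D.K) ((D.liftSeq c x m : D.K →L[ℂ] D.K)
      ((D.proj n : D.K →L[ℂ] D.K) ξ)) = (D.liftSeq c x n : D.K →L[ℂ] D.K) ξ at this
    rwa [hfix n hn] at this
  -- The shift by `k` is needed because `pₙ` is known to fix `ξ` only for `n ≥ k`.
  set r : ℕ → ℝ := fun n => ‖(D.liftSeq c x (k + n) : D.K →L[ℂ] D.K) ξ‖ ^ 2 with hr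
  have hdist : ∀ n m, n ≤ m → ‖(D.liftSeq c x (k + m) : D.K →L[ℂ] D.K) ξ -
      (D.liftSeq c x (k + n) : D.K →L[ℂ] D.K) ξ‖ ^ 2 = r m - r n := by
    intro n m h
    rw [← hproj (k + n) (k + m) (Nat.le_add_right _ _) (by omega), norm_sub_proj_sq,
      hproj (k + n) (k + m) (Nat.le_add_right _ _) (by omega)]
  have hmono : Monotone r := fun n m h => sub_nonneg.1 ((hdist n m h) ▸ sq_nonneg _)
  have hrc : CauchySeq r := by
    refine (tendsto_atTop_ciSup hmono ⟨(‖x‖ * ‖ξ‖) ^ 2, ?_⟩).cauchySeq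
    rintro _ ⟨n, rfl⟩
    exact pow_le_pow_left₀ (norm_nonneg _)
      (ContinuousLinearMap.le_of_opNorm_le _ (D.norm_liftSeq_le c x _) ξ) 2
  have hc : CauchySeq fun n => (D.liftSeq c x (k + n) : D.K →L[ℂ] D.K) ξ := by
    refine Metric.cauchySeq_iff'.2 fun ε hε => ?_
    obtain ⟨N, hN⟩ := Metric.cauchySeq_iff'.1 hrc (ε ^ 2) (by positivity)
    refine ⟨N, fun n hn => ?_⟩
    rw [dist_eq_norm]
    refine lt_of_pow_lt_pow_left₀ 2 hε.le ?_
    rw [hdist N n hn]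
    exact (le_abs_self _).trans_lt (hN n hn)
  refine (cauchySeq_shift k).1 ?_
  simpa only [add_comm] using hc

/-- The vectors `pₖ ξ` approximate `ξ`, and the uniform bound `‖x‖` on the sequence transfers the
Cauchy property. -/
lemma cauchySeq_liftSeq (hτ : τ 1 = 1) {c : Circle} {x : G →L[ℂ] G}
    (hx : τ x = (c : ℂ) • x) (ξ : D.K) :
    CauchySeq fun n => (D.liftSeq c x n : D.K →L[ℂ] D.K) ξ := by
  refine Metric.cauchySeq_iff'.2 fun ε hε => ?_
  have hx0 : 0 < ‖x‖ + 1 := by positivity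
  obtain ⟨k, hk⟩ := (Metric.tendsto_atTop.1 (D.sotTendsto_proj hτ ξ) (ε / (3 * (‖x‖ + 1)))
    (by positivity))
  specialize hk k le_rfl
  set η := (D.proj k : D.K →L[ℂ] D.K) ξ with hη
  have hη' : (D.proj k : D.K →L[ℂ] D.K) η = η :=
    congrArg (fun z : D.Alg => (z : D.K →L[ℂ] D.K) ξ) (D.proj_mul_self k)
  obtain ⟨N, hN⟩ := Metric.cauchySeq_iff'.1 (D.cauchySeq_liftSeq_proj hτ hx k η hη') (ε / 3)
    (by positivity)
  have hclose : ∀ n, dist ((D.liftSeq c x n : D.K →L[ℂ] D.K) ξ)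
      ((D.liftSeq c x n : D.K →L[ℂ] D.K) η) ≤ ε / 3 := by
    intro n
    rw [dist_eq_norm, ← map_sub]
    refine (ContinuousLinearMap.le_of_opNorm_le _ (D.norm_liftSeq_le c x n) _).trans ?_
    rw [← dist_eq_norm, dist_comm]
    have h1 : dist η ξ < ε / (3 * (‖x‖ + 1)) := hk
    rw [lt_div_iff₀ (by positivity)] at h1
    nlinarith [dist_nonneg (x := η) (y := ξ), norm_nonneg x]
  refine ⟨N, fun n hn => ?_⟩
  have h1 := hN n hn
  have h2 := hclose n
  have h3 := hclose N
  have h4 := dist_triangle4 ((D.liftSeq c x n : D.K →L[ℂ] D.K) ξ)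
    ((D.liftSeq c x n : D.K →L[ℂ] D.K) η) ((D.liftSeq c x N : D.K →L[ℂ] D.K) η)
    ((D.liftSeq c x N : D.K →L[ℂ] D.K) ξ)
  rw [dist_comm] at h3
  linarith

/-- Peripheral eigenvectors of `τ` lift to eigenvectors of `θ`. -/
lemma exists_eigen_lift (hτ : τ 1 = 1) {c : Circle} {x : G →L[ℂ] G} (hx : τ x = (c : ℂ) • x) :
    ∃ z : D.Alg, D.θ z = (c : ℂ) • z ∧ D.compression z = x ∧
      SOTTendsto (fun n => (D.liftSeq c x n : D.K →L[ℂ] D.K)) atTop z := by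
  obtain ⟨z₀, hz₀⟩ := exists_sotTendsto_of_cauchySeq (D.cauchySeq_liftSeq hτ hx)
  obtain ⟨z, rfl⟩ : ∃ z : D.Alg, (z : D.K →L[ℂ] D.K) = z₀ :=
    ⟨⟨z₀, mem_vonNeumannAlgebra_of_sotTendsto D.𝓑 hz₀ fun n => (D.liftSeq c x n).2⟩, rfl⟩
  have hcorner : ∀ n, D.proj n * z * D.proj n = D.liftSeq c x n := by
    intro n
    apply Subtype.ext
    refine ((hz₀.mul_left (D.proj n)).mul_right (D.proj n)).unique fun ξ => ?_
    refine tendsto_const_nhds.congr' ?_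
    filter_upwards [eventually_ge_atTop n] with m hm
    exact congrArg (fun z : D.Alg => (z : D.K →L[ℂ] D.K) ξ)
      (D.proj_mul_liftSeq_mul_proj hτ hx hm).symm
  -- The eigenvalue equation is checked corner by corner: `θ` carries the `n`-th corner of `z` to
  -- the `(n + 1)`-st corner of `θ z`, and `pₙ → 1` then removes the corners.
  have hθcorner : ∀ n, D.proj (n + 1) * D.θ z * D.proj (n + 1) =
      D.proj (n + 1) * ((c : ℂ) • z) * D.proj (n + 1) := by
    intro n
    have h1 := congrArg D.θ (hcorner n)
    rw [map_mul, map_mul] at h1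
    have h2 : D.θ (D.proj n) = D.proj (n + 1) := (Function.iterate_succ_apply' _ _ _).symm
    have h3 : D.θ (D.liftSeq c x n) = (c : ℂ) • D.liftSeq c x (n + 1) := by
      rw [liftSeq, map_smul, ← Function.iterate_succ_apply' D.θ, liftSeq, smul_smul]
      congr 1
      have h0 : (c : ℂ) ≠ 0 := c.coe_ne_zero
      field_simp
      ring
    rw [h2, h3] at h1
    rw [h1, mul_smul_comm, smul_mul_assoc, hcorner]
  refine ⟨z, ?_, ?_, hz₀⟩
  · refine D.alg_ext fun ξ => ?_
    refine tendsto_nhds_unique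
      ((D.tendsto_proj_mul_mul_proj hτ (D.θ z) ξ).comp (tendsto_add_atTop_nat 1)) ?_
    refine ((D.tendsto_proj_mul_mul_proj hτ ((c : ℂ) • z) ξ).comp
      (tendsto_add_atTop_nat 1)).congr fun n => ?_
    exact congrArg (fun z : D.Alg => (z : D.K →L[ℂ] D.K) ξ) (hθcorner n).symm
  · apply D.corner_injective
    rw [← proj_zero_mul_mul, hcorner, liftSeq]
    simp

/-! ### Bijectivity of the compression and the peripheral product. -/

/-- An isometry on a complete space has closed range; the range contains every peripheral
eigenvector of `τ`, hence their closed span. -/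
lemma bijOn_compression (hτ : τ 1 = 1) :
    Set.BijOn D.compression (peripheralPoissonBoundary D.θ) (peripheralPoissonBoundary τ) := by
  refine ⟨D.mapsTo_compression hτ, D.injOn_compression hτ, ?_⟩
  have : CompleteSpace D.Alg := (isClosed_vonNeumannAlgebra D.𝓑).completeSpace_coe
  have : CompleteSpace D.boundary :=
    (Submodule.isClosed_topologicalClosure _).completeSpace_coe
  set f : D.boundary →L[ℂ] (G →L[ℂ] G) := D.compressionCLM.comp D.boundary.subtypeL with hf
  have hanti : AntilipschitzWith 1 f :=
    AddMonoidHomClass.antilipschitz_of_bound f fun z => by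
      rw [NNReal.coe_one, one_mul]
      exact D.norm_le_norm_compression hτ z.2
  have hcl : IsClosed (Set.range f) := hanti.isClosed_range f.uniformContinuous
  have hspan : (Submodule.span ℂ (⋃ z : Circle, peripheralEigenspace τ z) : Set (G →L[ℂ] G)) ⊆
      Set.range f := by
    have : Submodule.span ℂ (⋃ z : Circle, peripheralEigenspace τ z) ≤
        LinearMap.range (f : D.boundary →ₗ[ℂ] (G →L[ℂ] G)) := by
      rw [Submodule.span_le]
      intro x hx
      obtain ⟨c, hc⟩ := Set.mem_iUnion.1 hx
      obtain ⟨z, hz, hzx, -⟩ := D.exists_eigen_lift hτ hc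
      exact ⟨⟨z, eigenspace_subset_peripheralPoissonBoundary hz⟩, hzx⟩
    exact this
  intro y hy
  obtain ⟨z, hz⟩ := closure_minimal hspan hcl hy
  exact ⟨z, z.2, hz⟩

lemma lift_eq (hτ : τ 1 = 1) {z : D.Alg} (hz : z ∈ peripheralPoissonBoundary D.θ) {x : G →L[ℂ] G}
    (hx : D.compression z = x) : D.lift x = z := by
  have h : ∃ z ∈ peripheralPoissonBoundary D.θ, D.compression z = x := ⟨z, hz, hx⟩
  exact D.injOn_compression hτ (Function.invFunOn_mem h) hz
    ((Function.invFunOn_eq h).trans hx.symm)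

/-- The peripheral product of eigenvectors is a strong limit. -/
lemma sotTendsto_peripheralProduct (hτ : τ 1 = 1) {c d : Circle} {x y : G →L[ℂ] G}
    (hx : τ x = (c : ℂ) • x) (hy : τ y = (d : ℂ) • y) :
    SOTTendsto (fun n : ℕ => (((c : ℂ) * d) ^ n)⁻¹ • τ^[n] (x * y)) atTop
      (D.peripheralProduct x y) := by
  obtain ⟨z, hz, hzx, hzl⟩ := D.exists_eigen_lift hτ hx
  obtain ⟨w, hw, hwy, hwl⟩ := D.exists_eigen_lift hτ hy
  rw [peripheralProduct, D.lift_eq hτ (eigenspace_subset_peripheralPoissonBoundary hz) hzx,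
    D.lift_eq hτ (eigenspace_subset_peripheralPoissonBoundary hw) hwy]
  intro h
  -- Multiplication is strongly continuous on bounded sets: the left factors are bounded by `‖x‖`
  -- and act on vectors tending to 0.
  have h1 : Tendsto (fun n => (D.liftSeq c x n : D.K →L[ℂ] D.K)
      ((D.liftSeq d y n : D.K →L[ℂ] D.K) (D.V h) - (w : D.K →L[ℂ] D.K) (D.V h))) atTop (𝓝 0) := by
    have h2 := ((hwl (D.V h)).sub_const ((w : D.K →L[ℂ] D.K) (D.V h))).norm.const_mul ‖x‖
    rw [sub_self, norm_zero, mul_zero] at h2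
    exact squeeze_zero_norm
      (fun n => ContinuousLinearMap.le_of_opNorm_le _ (D.norm_liftSeq_le c x n) _) h2
  have h3 := h1.add (hzl ((w : D.K →L[ℂ] D.K) (D.V h)))
  rw [zero_add] at h3
  refine (((ContinuousLinearMap.adjoint D.V.toContinuousLinearMap).continuous.tendsto _).comp
    h3).congr fun n => ?_
  rw [Function.comp_apply, map_sub, sub_add_cancel]
  -- Multiplicativity of `θⁿ` and of the corner embedding merges the two factors into `θⁿ(xy)`,
  -- which compresses to `τⁿ(xy)`.
  have h4 : (((c : ℂ) * d) ^ n)⁻¹ • τ^[n] (x * y) =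
      D.compression (D.liftSeq c x n * D.liftSeq d y n) := by
    rw [← compression_theta_iterate_corner, corner_mul, iterate_map_mul D.θ, liftSeq, liftSeq,
      smul_mul_smul_comm, mul_pow, mul_inv]
    exact (D.compressionCLM.map_smul _ _).symm
  exact (congrArg (fun t : G →L[ℂ] G => t h) h4).symm

end MinimalDilation
end PeripheralPoisson

end

open PeripheralPoisson in
theorem mainTheorem9 {Θ : Type w} [Countable Θ] [Nontrivial Θ]
    {H : Type u} [NormedAddCommGroup H] [InnerProductSpace ℂ H] [CompleteSpace H]
    (e : HilbertBasis Θ ℂ H) (ω : Θ → ℝ) (hω : ∀ i, 0 < ω i) (hsum : HasSum ω 1)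
    (a b : FockSpace H →L[ℂ] FockSpace H)
    (ha : a ∈ poissonBoundary (fockMap e ω)) (hb : b ∈ poissonBoundary (fockMap e ω))
    (z w : Circle) (hz : z ≠ 1) (hw : w ≠ 1) :
    SOTTendsto (fun n : ℕ => (fockMap e ω)^[n] (a * b)) atTop (choiEffros (fockMap e ω) a b) ∧
    phase z * a ∈ peripheralPoissonBoundary (fockMap e ω) ∧
    b * phase w ∈ peripheralPoissonBoundary (fockMap e ω) ∧
    SOTTendsto
      (fun n : ℕ => (((z : ℂ) * (w : ℂ)) ^ n)⁻¹ •
        (fockMap e ω)^[n] ((phase z * a) * (b * phase w)))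
      atTop (phase z * choiEffros (fockMap e ω) a b * phase w) ∧
    ∀ D : MinimalDilation.{u, v} (fockMap (H := H) e ω),
      Set.BijOn D.compression (peripheralPoissonBoundary D.θ)
        (peripheralPoissonBoundary (fockMap e ω)) ∧
      D.peripheralProduct (phase z * a) (b * phase w) =
        phase z * choiEffros (fockMap e ω) a b * phase w := by
  have he := e.orthonormal
  have ha' : fockMap e ω a = a := ha
  have hb' : fockMap e ω b = b := hb
  have hlim := sotTendsto_choiEffros (exists_sotTendsto_fockMap_mul he hω hsum ha' hb')
  have hza : fockMap e ω (phase z * a) = (z : ℂ) • (phase z * a) := by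
    rw [fockMap_phase_mul he hω hsum, ha']
  have hbw : fockMap e ω (b * phase w) = (w : ℂ) • (b * phase w) := by
    rw [fockMap_mul_phase he hω hsum, hb']
  have hprod : SOTTendsto
      (fun n : ℕ => (((z : ℂ) * (w : ℂ)) ^ n)⁻¹ •
        (fockMap e ω)^[n] ((phase z * a) * (b * phase w)))
      atTop (phase z * choiEffros (fockMap e ω) a b * phase w) := by
    intro ξ
    refine ((hlim.mul_left (phase z)).mul_right (phase w) ξ).congr fun n => ?_
    have h0 : ((z : ℂ) * w) ^ n ≠ 0 := pow_ne_zero _ (mul_ne_zero z.coe_ne_zero w.coe_ne_zero)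
    have h2 : phase z * a * (b * phase w) = phase z * (a * b) * phase w := by
      simp only [mul_assoc]
    beta_reduce
    rw [h2, fockMap_iterate_phase_mul_mul_phase he hω hsum, inv_smul_smul₀ h0]
  have h1 := fockMap_one he hω hsum
  -- The product in the dilation and the Fock space computation are limits of one sequence, so they
  -- agree.
  exact ⟨hlim, eigenspace_subset_peripheralPoissonBoundary hza,
    eigenspace_subset_peripheralPoissonBoundary hbw, hprod, fun D =>
    ⟨D.bijOn_compression h1, (D.sotTendsto_peripheralProduct h1 hza hbw).unique hprod⟩⟩
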